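/- All graphs are finite and simple. Let $\delta(G)$ and $\Delta(G)$ denote the minimum and the maximum degree of a graph $G$. A graph is traceable if it contains a spanning path (a path through all of its vertices), and a Hamiltonian cycle is a spanning cycle. The Cartesian product $G_1\square G_2$ has vertex set $V(G_1)\times V(G_2)$, with $(v,u)$ and $(v',u')$ adjacent if and only if either $v=v'$ and $uu'\in E(G_2)$, or $u=u'$ and $vv'\in E(G_1)$. Let $G_2$ be a connected graph with at least two vertices such that $2\delta(G_2)\ge \Delta(G_2)$, and let $G_1$ be a traceable graph whose order $|V(G_1)|$ is even. If $|V(G_1)|\ge 4\Delta(G_2)-2$, then $G_1\square G_2$ has a Hamiltonian cycle. -/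

import Mathlib

/-- A graph is traceable if it contains a spanning path, that is, a walk visiting every vertex
exactly once. -/
def SimpleGraph.IsTraceable {V : Type*} [DecidableEq V] (G : SimpleGraph V) : Prop :=
  ∃ (a b : V) (p : G.Walk a b), p.IsHamiltonian

/-- A graph contains a Hamiltonian (spanning) cycle. Unlike the predicate
`SimpleGraph.IsHamiltonian`, this makes no exception for the one-vertex graph. -/
def SimpleGraph.HasHamiltonianCycle {V : Type*} [DecidableEq V] (G : SimpleGraph V) : Prop :=
  ∃ (a : V) (p : G.Walk a a), p.IsHamiltonianCycle

namespace SimpleGraph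

/-! Only a spanning path of $G_1$ matters, so $G_1$ may be taken to be a path with $2(m+1)$
vertices; write $d=\Delta(G_2)$. The degree condition and Hall's theorem let each vertex of $G_2$
choose a neighbour with no vertex chosen more than twice. An extremal choice has $f^3=f$
(`exists_involutive_neighbor_choice`), so its components are paths on 2, 3 or 4 vertices; cutting
the last kind in half partitions $V(G_2)$ into paths on 2 or 3 vertices.

Over each piece the product contains a grid with a spanning cycle rich in rungs. Pieces are joined
along an edge $uv$ of $G_2$: if both cycles use the rung with the same index $j$ over $u$ and over
$v$, exchanging these rungs for the two row edges merges the cycles (`IsMergeable.union`).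

Rungs never run out, because of the invariant in `IsMergeable`: available rungs over $w$ plus
neighbours of $w$ already absorbed number at least $d$. A merge costs $u$ and $v$ one rung each and
gains each a neighbour; a vertex with a neighbour still outside thus has a rung left. Matching
indices is no obstacle, since the cycle over a new piece can be chosen to contain any prescribed
rung (`IsFlexible`). The outer columns of a three-column grid share the $m$ indices and need $d-1$
each, so $m\ge 2d-2$, which is $|V(G_1)|\ge 4d-2$. -/

/-- `G` has a path from `a` to `b` whose vertex set is `S` and which uses all edges in `E`. -/
def SpansPath {α : Type*} (G : SimpleGraph α) (S : Set α) (E : Set (Sym2 α)) (a b : α) : Prop :=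
  ∃ p : G.Walk a b, p.IsPath ∧ (∀ x, x ∈ p.support ↔ x ∈ S) ∧ ∀ e ∈ E, e ∈ p.edges

/-- `G` has a cycle whose vertex set is `S` and which uses all edges in `E`; a single edge
traversed back and forth is allowed as a cycle. -/
def SpansCycle {α : Type*} (G : SimpleGraph α) (S : Set α) (E : Set (Sym2 α)) : Prop :=
  ∃ a b F, G.Adj b a ∧ G.SpansPath S F a b ∧ E ⊆ insert s(a, b) F

/-! ### Cutting, joining and merging paths and cycles -/

section Spanning

variable {α : Type*} {G : SimpleGraph α} {S T : Set α} {E F : Set (Sym2 α)} {a b c d : α}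

theorem SpansPath.mono (h : G.SpansPath S E a b) (hF : F ⊆ E) : G.SpansPath S F a b := by
  obtain ⟨p, hp, hS, hE⟩ := h
  exact ⟨p, hp, hS, fun e he => hE e (hF he)⟩

theorem SpansPath.symm (h : G.SpansPath S E a b) : G.SpansPath S E b a := by
  obtain ⟨p, hp, hS, hE⟩ := h
  exact ⟨p.reverse, hp.reverse, by simpa using hS, by simpa using hE⟩

theorem spansPath_singleton (a : α) : G.SpansPath {a} ∅ a a :=
  ⟨Walk.nil, by simp, by simp, by simp⟩

theorem SpansPath.append (h₁ : G.SpansPath S E a b) (h₂ : G.SpansPath T F c d)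
    (hST : Disjoint S T) (hbc : G.Adj b c) :
    G.SpansPath (S ∪ T) (insert s(b, c) (E ∪ F)) a d := by
  obtain ⟨p, hp, hS, hE⟩ := h₁
  obtain ⟨q, hq, hT, hF⟩ := h₂
  refine ⟨p.append (Walk.cons hbc q), ?_, ?_, ?_⟩
  · rw [Walk.isPath_def, Walk.support_append, Walk.support_cons, List.tail_cons,
      List.nodup_append']
    refine ⟨hp.support_nodup, hq.support_nodup, fun x hx hx' => ?_⟩
    exact Set.disjoint_left.1 hST ((hS x).1 hx) ((hT x).1 hx')
  · intro x
    rw [Walk.support_append, Walk.support_cons, List.tail_cons, List.mem_append, hS, hT]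
    rfl
  · intro e he
    rw [Walk.edges_append, Walk.edges_cons, List.mem_append, List.mem_cons]
    rcases he with he | he | he
    · exact Or.inr (Or.inl he)
    · exact Or.inl (hE e he)
    · exact Or.inr (Or.inr (hF e he))

theorem SpansPath.concat (h : G.SpansPath S E a b) (hc : c ∉ S) (hbc : G.Adj b c) :
    G.SpansPath (insert c S) (insert s(b, c) E) a c := by
  have := h.append (spansPath_singleton c) (Set.disjoint_singleton_right.2 hc) hbc
  rwa [Set.union_empty, Set.union_singleton] at this

theorem SpansPath.cons (h : G.SpansPath S E a b) (hc : c ∉ S) (hac : G.Adj a c) :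
    G.SpansPath (insert c S) (insert s(a, c) E) c b :=
  (h.symm.concat hc hac).symm

theorem SpansPath.spansCycle (h : G.SpansPath S E a b) (hba : G.Adj b a) :
    G.SpansCycle S (insert s(a, b) E) :=
  ⟨a, b, E, hba, h, subset_rfl⟩

theorem SpansCycle.mono (h : G.SpansCycle S E) (hF : F ⊆ E) : G.SpansCycle S F := by
  obtain ⟨a, b, E', hab, h, hE⟩ := h
  exact ⟨a, b, E', hab, h, hF.trans hE⟩

theorem Walk.exists_eq_append_cons_of_mem_edges {u v : α} (p : G.Walk u v) {e : Sym2 α}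
    (he : e ∈ p.edges) : ∃ (x y : α) (h : G.Adj x y) (p₁ : G.Walk u x) (p₂ : G.Walk y v),
      e = s(x, y) ∧ p = p₁.append (Walk.cons h p₂) := by
  induction p with
  | nil => simp at he
  | cons h q ih =>
    rw [Walk.edges_cons, List.mem_cons] at he
    rcases he with he | he
    · exact ⟨_, _, h, Walk.nil, q, he, rfl⟩
    · obtain ⟨x, y, h', p₁, p₂, rfl, rfl⟩ := ih he
      exact ⟨x, y, h', Walk.cons h p₁, p₂, rfl, rfl⟩

/-- A cycle can be cut open at any of its edges. -/
theorem SpansCycle.spansPath (h : G.SpansCycle S E) (hab : s(a, b) ∈ E) :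
    G.SpansPath S (E \ {s(a, b)}) a b := by
  obtain ⟨c, d, F, hdc, hF, hE⟩ := h
  rcases eq_or_ne s(a, b) s(c, d) with heq | hne
  · have hsub : E \ {s(a, b)} ⊆ F := by
      rintro e ⟨he, he'⟩
      rcases hE he with h | h
      · exact absurd (h.trans heq.symm) he'
      · exact h
    rcases Sym2.eq_iff.1 heq with ⟨rfl, rfl⟩ | ⟨rfl, rfl⟩
    · exact hF.mono hsub
    · exact hF.symm.mono hsub
  · obtain ⟨p, hp, hS, hpE⟩ := hF
    have hmem : s(a, b) ∈ p.edges := hpE _ ((hE hab).resolve_left hne)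
    obtain ⟨x, y, hxy, p₁, p₂, he, rfl⟩ := p.exists_eq_append_cons_of_mem_edges hmem
    -- The cut edge lies inside the path, so rotate: the part after it, the closing edge, then the
    -- part before it.
    have key : G.SpansPath S (E \ {s(a, b)}) y x := by
      rw [Walk.isPath_def, Walk.support_append, Walk.support_cons, List.tail_cons] at hp
      refine ⟨p₂.append (Walk.cons hdc p₁), ?_, ?_, ?_⟩
      · rw [Walk.isPath_def, Walk.support_append, Walk.support_cons, List.tail_cons]
        exact List.nodup_append_comm.1 hp
      · intro z
        rw [← hS, Walk.support_append, Walk.support_cons, List.tail_cons, Walk.support_append,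
          Walk.support_cons, List.tail_cons, List.mem_append, List.mem_append, or_comm]
      · rintro e ⟨heE, hne'⟩
        rw [Walk.edges_append, Walk.edges_cons, List.mem_append, List.mem_cons]
        rcases hE heE with h | h
        · exact Or.inr (Or.inl (h.trans Sym2.eq_swap))
        · have := hpE e h
          rw [Walk.edges_append, Walk.edges_cons, List.mem_append, List.mem_cons] at this
          rcases this with h | h | h
          · exact Or.inr (Or.inr h)
          · exact absurd (h.trans he.symm) hne'
          · exact Or.inl h
    rcases Sym2.eq_iff.1 he with ⟨rfl, rfl⟩ | ⟨rfl, rfl⟩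
    · exact key.symm
    · exact key

/-- Two disjoint cycles through the opposite sides `ab` and `cd` of a four-cycle can be merged. -/
theorem SpansCycle.merge (h₁ : G.SpansCycle S E) (h₂ : G.SpansCycle T F) (hST : Disjoint S T)
    (hab : s(a, b) ∈ E) (hcd : s(c, d) ∈ F) (hac : G.Adj a c) (hbd : G.Adj b d) :
    G.SpansCycle (S ∪ T) (E \ {s(a, b)} ∪ F \ {s(c, d)}) := by
  have := ((h₁.spansPath hab).symm.append (h₂.spansPath hcd) hST hac).spansCycle hbd.symm
  exact this.mono fun e he => Or.inr (Or.inr he)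

/-- Three distinct vertices exclude the degenerate back-and-forth cycle, so the closing edge is not
already on the path. -/
theorem SpansCycle.hasHamiltonianCycle {β : Type*} [DecidableEq β] {H : SimpleGraph β}
    (h : G.SpansCycle S E) (φ : G →g H) (hinj : Set.InjOn φ S) (hsurj : ∀ y, ∃ x ∈ S, φ x = y)
    (hthree : ∃ x ∈ S, ∃ y ∈ S, ∃ z ∈ S, x ≠ y ∧ x ≠ z ∧ y ≠ z) : H.HasHamiltonianCycle := by
  obtain ⟨a, b, F, hba, ⟨p, hp, hS, -⟩, -⟩ := h
  have hq : (p.map φ).IsPath := by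
    rw [Walk.isPath_def, Walk.support_map]
    exact hp.support_nodup.map_on fun x hx y hy hxy => hinj ((hS x).1 hx) ((hS y).1 hy) hxy
  have hlen : 2 ≤ p.length := by
    by_contra! hlt
    obtain ⟨x, hx, y, hy, z, hz, hxy, hxz, hyz⟩ := hthree
    rw [← hS] at hx hy hz
    have hsub : ({x, y, z} : Set α) ⊆ {w | w ∈ p.support} := by
      rintro w (rfl | rfl | rfl) <;> assumption
    classical
    have hcard : ({x, y, z} : Finset α).card ≤ p.support.toFinset.card :=
      Finset.card_le_card fun w hw => by
        simp only [Finset.mem_insert, Finset.mem_singleton] at hw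
        exact List.mem_toFinset.2 (hsub hw)
    rw [Finset.card_eq_three.2 ⟨x, y, z, hxy, hxz, hyz, rfl⟩] at hcard
    have := p.support.toFinset_card_le
    rw [Walk.length_support] at this
    omega
  refine ⟨φ b, Walk.cons (φ.map_adj hba) (p.map φ), ?_⟩
  have hcyc : (Walk.cons (φ.map_adj hba) (p.map φ)).IsCycle := by
    rw [Walk.cons_isCycle_iff]
    refine ⟨hq, fun hmem => ?_⟩
    have h1 : (p.map φ).length = 1 := by
      rw [Sym2.eq_swap] at hmem
      exact hq.length_eq_one_of_mem_edges hmem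
    rw [Walk.length_map] at h1
    omega
  rw [Walk.isHamiltonianCycle_iff_isCycle_and_support_count_tail_eq_one]
  refine ⟨hcyc, fun y => ?_⟩
  rw [Walk.support_cons, List.tail_cons]
  apply List.count_eq_one_of_mem hq.support_nodup
  obtain ⟨x, hx, rfl⟩ := hsurj y
  rw [Walk.support_map]
  exact List.mem_map_of_mem ((hS x).2 hx)

end Spanning

/-! ### Neighbour choices with small fibres -/

section Functional

variable {W : Type*} [Fintype W] [DecidableEq W]

/-- By Hall's theorem, if `Δ ≤ 2δ` then every vertex can choose a neighbour so that
no vertex is chosen more than twice. -/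
theorem exists_neighbor_choice (G : SimpleGraph W) [DecidableRel G.Adj]
    (hpos : 0 < G.minDegree) (hdeg : G.maxDegree ≤ 2 * G.minDegree) :
    ∃ f : W → W, (∀ v, G.Adj v (f v)) ∧ ∀ w, (Finset.univ.filter fun v => f v = w).card ≤ 2 := by
  -- Doubling each neighbourhood with `Bool` turns "chosen at most twice" into injectivity. Hall's
  -- condition follows by counting edges between `s` and its neighbourhood.
  obtain ⟨g, hinj, hg⟩ := (Finset.all_card_le_biUnion_card_iff_exists_injective
    (fun v : W => G.neighborFinset v ×ˢ (Finset.univ : Finset Bool))).1 (by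
      intro s
      have hU : (s.biUnion fun v : W => G.neighborFinset v ×ˢ (Finset.univ : Finset Bool))
          = (s.biUnion fun v => G.neighborFinset v) ×ˢ (Finset.univ : Finset Bool) := by
        ext ⟨x, t⟩; simp
      rw [hU, Finset.card_product, Finset.card_univ, Fintype.card_bool]
      set t := s.biUnion fun v => G.neighborFinset v
      have hcount : s.card * G.minDegree ≤ t.card * G.maxDegree := by
        apply Finset.card_mul_le_card_mul G.Adj
        · intro a ha
          refine (G.minDegree_le_degree a).trans ?_
          rw [← card_neighborFinset_eq_degree]
          refine Finset.card_le_card fun x hx => ?_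
          rw [Finset.mem_bipartiteAbove]
          exact ⟨Finset.mem_biUnion.2 ⟨a, ha, hx⟩, (G.mem_neighborFinset a x).1 hx⟩
        · intro b _
          refine le_trans ?_ (G.degree_le_maxDegree b)
          rw [← card_neighborFinset_eq_degree]
          refine Finset.card_le_card fun x hx => ?_
          rw [Finset.mem_bipartiteBelow] at hx
          exact (G.mem_neighborFinset b x).2 hx.2.symm
      have h2 : s.card * G.minDegree ≤ t.card * 2 * G.minDegree :=
        hcount.trans (by rw [mul_assoc]; exact Nat.mul_le_mul_left _ hdeg)
      exact Nat.le_of_mul_le_mul_right h2 hpos)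
  refine ⟨fun v => (g v).1, fun v => ?_, fun w => ?_⟩
  · have := hg v
    rw [Finset.mem_product] at this
    exact (G.mem_neighborFinset v _).1 this.1
  · rw [← Fintype.card_bool, ← Finset.card_univ]
    refine Finset.card_le_card_of_injOn (fun v => (g v).2) (fun _ _ => Finset.mem_univ _) ?_
    intro x hx y hy hxy
    simp only [Finset.coe_filter, Finset.mem_univ, true_and, Set.mem_ofPred_eq] at hx hy
    exact hinj (Prod.ext (hx.trans hy.symm) hxy)

/-- The choice can be made so that every chosen vertex is chosen back by the one it chooses. -/
theorem exists_involutive_neighbor_choice (G : SimpleGraph W) [DecidableRel G.Adj]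
    (hpos : 0 < G.minDegree) (hdeg : G.maxDegree ≤ 2 * G.minDegree) :
    ∃ f : W → W, (∀ v, G.Adj v (f v)) ∧
      (∀ w, (Finset.univ.filter fun v => f v = w).card ≤ 2) ∧ ∀ v, f (f (f v)) = f v := by
  let good : Set (W → W) := {f | (∀ v, G.Adj v (f v)) ∧
    ∀ w, (Finset.univ.filter fun v => f v = w).card ≤ 2}
  have hne : good.Nonempty := G.exists_neighbor_choice hpos hdeg
  -- Extremal choice: as many vertices as possible on two-cycles of `f`.
  obtain ⟨f, ⟨hadj, hfib⟩, hmax⟩ := Set.exists_max_image good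
    (fun f => (Finset.univ.filter fun v => f (f v) = v).card) (Set.toFinite _) hne
  refine ⟨f, hadj, hfib, ?_⟩
  -- a child of a chosen vertex outside the two-cycles has itself exactly two children
  have key : ∀ x, f (f (f x)) ≠ f x → (Finset.univ.filter fun v => f v = x).card = 2 := by
    intro x hx
    by_contra hcard
    have hlt : (Finset.univ.filter fun v => f v = x).card ≤ 1 := by
      have := hfib x
      omega
    set w := f x with hw
    have hwx : x ≠ w := (hadj x).ne
    -- Redirecting `w` to `x` creates a new two-cycle and destroys none, as `w` lies on none; the
    -- fibre of `x` has room for `w`.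
    have hmem : Function.update f w x ∈ good := by
      refine ⟨fun v => ?_, fun u => ?_⟩
      · by_cases hv : v = w
        · subst hv
          rw [Function.update_self]
          exact (hadj x).symm
        · rw [Function.update_of_ne hv]
          exact hadj v
      · by_cases hu : u = x
        · subst hu
          have hsub : (Finset.univ.filter fun v => Function.update f w u v = u) ⊆
              insert w (Finset.univ.filter fun v => f v = u) := by
            intro v hv
            rw [Finset.mem_insert, Finset.mem_filter]
            by_cases hvw : v = w
            · exact Or.inl hvw
            · rw [Finset.mem_filter, Function.update_of_ne hvw] at hv
              exact Or.inr hv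
          have h1 := Finset.card_le_card hsub
          have h2 := Finset.card_insert_le w (Finset.univ.filter fun v => f v = u)
          omega
        · refine le_trans (Finset.card_le_card fun v hv => ?_) (hfib u)
          rw [Finset.mem_filter] at hv ⊢
          refine ⟨hv.1, ?_⟩
          by_cases hvw : v = w
          · subst hvw
            rw [Function.update_self] at hv
            exact absurd hv.2.symm hu
          · rw [Function.update_of_ne hvw] at hv
            exact hv.2
    have hle := hmax _ hmem
    refine absurd hle (not_le.2 (Finset.card_lt_card ?_))
    rw [Finset.ssubset_iff_of_subset]
    · refine ⟨w, ?_, ?_⟩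
      · rw [Finset.mem_filter, Function.update_self, Function.update_of_ne hwx]
        exact ⟨Finset.mem_univ _, hw.symm⟩
      · rw [Finset.mem_filter]
        exact fun h => hx h.2
    · intro v hv
      rw [Finset.mem_filter] at hv ⊢
      refine ⟨hv.1, ?_⟩
      have h1 : v ≠ w := fun h => hx (h ▸ hv.2)
      have h2 : f v ≠ w := by
        intro h
        apply hx
        have : f w = v := h ▸ hv.2
        rw [this, h]
      rw [Function.update_of_ne h1, Function.update_of_ne h2]
      exact hv.2
  by_contra! hex
  obtain ⟨v₀, hv₀⟩ := hex
  -- Each element of `Z` has two preimages, all again in `Z`, so `2 * Z.card ≤ Z.card` and `Z` is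
  -- empty.
  let Z := Finset.univ.filter fun x => f (f (f x)) ≠ f x
  have hsum : (Z.biUnion fun x => Finset.univ.filter fun v => f v = x).card = ∑ x ∈ Z, 2 := by
    rw [Finset.card_biUnion]
    · exact Finset.sum_congr rfl fun x hx => key x (Finset.mem_filter.1 hx).2
    · intro x _ y _ hxy
      rw [Function.onFun, Finset.disjoint_filter]
      exact fun v _ h1 h2 => hxy (h1.symm.trans h2)
  have hsub : (Z.biUnion fun x => Finset.univ.filter fun v => f v = x) ⊆ Z := by
    intro v hv
    obtain ⟨x, hx, hvx⟩ := Finset.mem_biUnion.1 hv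
    have hvx' : f v = x := (Finset.mem_filter.1 hvx).2
    refine Finset.mem_filter.2 ⟨Finset.mem_univ _, fun h => (Finset.mem_filter.1 hx).2 ?_⟩
    rw [← hvx', h]
  have hle := Finset.card_le_card hsub
  rw [hsum, Finset.sum_const, smul_eq_mul] at hle
  have hpos : 0 < Z.card := Finset.card_pos.2 ⟨v₀, Finset.mem_filter.2 ⟨Finset.mem_univ _, hv₀⟩⟩
  omega

end Functional

/-! ### Spanning cycles of grids with two or three columns -/

/-- The path on the vertices `0, …, n - 1`, as a graph on `ℕ`. -/
def initialPath (n : ℕ) : SimpleGraph ℕ where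
  Adj i j := (i + 1 = j ∨ j + 1 = i) ∧ i < n ∧ j < n
  symm := ⟨fun _ _ h => ⟨h.1.symm, h.2.2, h.2.1⟩⟩
  loopless := ⟨fun _ h => by rcases h.1 with h | h <;> omega⟩

/-- The first `k` copies of the vertex set `Q`. -/
def layers {W : Type*} (k : ℕ) (Q : Set W) : Set (ℕ × W) := {x | x.1 < k ∧ x.2 ∈ Q}

/-- The edge joining the copies `i` and `i + 1` of the vertex `w`. -/
def rung {W : Type*} (i : ℕ) (w : W) : Sym2 (ℕ × W) := s((i, w), (i + 1, w))

section Grid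

variable {W : Type*} {G : SimpleGraph W} {n : ℕ}

@[simp] theorem mem_layers {k : ℕ} {Q : Set W} {i : ℕ} {w : W} :
    (i, w) ∈ layers k Q ↔ i < k ∧ w ∈ Q := Iff.rfl

theorem rung_injective {i j : ℕ} {v w : W} (h : rung i v = rung j w) : i = j ∧ v = w := by
  simp only [rung, Sym2.eq_iff, Prod.mk.injEq] at h
  rcases h with h | h
  · exact h.1
  · omega

theorem rung_ne_of_fst_eq {i r : ℕ} {v x y : W} : rung i v ≠ s((r, x), (r, y)) := by
  simp only [rung, ne_eq, Sym2.eq_iff, Prod.mk.injEq]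
  omega

theorem adj_row {i : ℕ} {x y : W} (h : G.Adj x y) : (initialPath n □ G).Adj (i, x) (i, y) :=
  boxProd_adj.2 (Or.inr ⟨h, rfl⟩)

theorem adj_rung {i : ℕ} (x : W) (h : i + 1 < n) :
    (initialPath n □ G).Adj (i, x) (i + 1, x) :=
  boxProd_adj.2 (Or.inl ⟨⟨Or.inl rfl, by omega, h⟩, rfl⟩)

/-- A ladder has a spanning path that uses all edges of the two columns. -/
theorem spansPath_ladder {x y : W} (hxy : G.Adj x y) (k : ℕ) (hk : k < n) :
    (initialPath n □ G).SpansPath (layers (k + 1) {x, y})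
      {e | ∃ i < k, ∃ w ∈ ({x, y} : Set W), e = rung i w} (k, x) (k, y) := by
  have hne := hxy.ne
  induction k with
  | zero =>
    have h := (spansPath_singleton (G := initialPath n □ G) (0, x)).concat (c := (0, y))
      (by simpa using hne.symm) (adj_row hxy)
    have hset : insert (0, y) {(0, x)} = layers (0 + 1) ({x, y} : Set W) := by
      ext ⟨i, w⟩
      simp only [Set.mem_insert_iff, Set.mem_singleton_iff, Prod.mk.injEq, mem_layers]
      grind
    rw [hset] at h
    refine h.mono ?_
    rintro e ⟨i, hi, -⟩
    omega
  | succ k ih =>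
    have h := ((ih (by omega)).cons (c := (k + 1, x)) (by simp) (adj_rung x hk)).concat
      (c := (k + 1, y)) (by simp [hne.symm]) (adj_rung y hk)
    have hset : insert (k + 1, y) (insert (k + 1, x) (layers (k + 1) {x, y})) =
        layers (k + 1 + 1) ({x, y} : Set W) := by
      ext ⟨i, w⟩
      simp only [Set.mem_insert_iff, Set.mem_singleton_iff, Prod.mk.injEq, mem_layers]
      grind
    rw [hset] at h
    refine h.mono ?_
    rintro e ⟨i, hi, w, hw, rfl⟩
    rcases Nat.lt_succ_iff_lt_or_eq.1 hi with hi | rfl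
    · exact Or.inr (Or.inr ⟨i, hi, w, hw, rfl⟩)
    · rcases hw with rfl | rfl
      · exact Or.inr (Or.inl rfl)
      · exact Or.inl rfl

/-- A cycle spanning the first `r + 1` rows of a grid with three columns extends to the next two
rows. -/
theorem SpansCycle.add_two_rows {x y z : W} (hxy : G.Adj x y) (hyz : G.Adj y z) (hxz : x ≠ z)
    {r : ℕ} (hr : r + 2 < n) {E : Set (Sym2 (ℕ × W))}
    (h : (initialPath n □ G).SpansCycle (layers (r + 1) {x, y, z}) E)
    (hE : s((r, x), (r, y)) ∈ E) :
    (initialPath n □ G).SpansCycle (layers (r + 3) {x, y, z})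
      (E \ {s((r, x), (r, y))} ∪ {rung r x, rung r y, s((r + 2, x), (r + 2, y)),
        s((r + 2, y), (r + 2, z))}) := by
  have hxy' := hxy.ne
  have hyz' := hyz.ne
  -- Cut at the top edge `xy`. From `x` climb two rows; from `y` climb one, cross to `z`, climb one,
  -- cross back. Rung `r` is used over `x` and `y` but not over `z`.
  have h' := ((((((h.spansPath hE).cons (c := (r + 1, x)) (by simp)
    (adj_rung x (by omega))).cons (c := (r + 2, x)) (by simp) (adj_rung x (by omega))).concat
    (c := (r + 1, y)) (by simp [hxy'.symm]) (adj_rung y (by omega))).concat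
    (c := (r + 1, z)) (by simp [hxz.symm, hyz'.symm]) (adj_row hyz)).concat
    (c := (r + 2, z)) (by simp [hxz.symm]) (adj_rung z (by omega))).concat
    (c := (r + 2, y)) (by simp [hxy'.symm, hyz']) (adj_row hyz.symm)
  have hset : insert (r + 2, y) (insert (r + 2, z) (insert (r + 1, z) (insert (r + 1, y)
      (insert (r + 2, x) (insert (r + 1, x) (layers (r + 1) {x, y, z})))))) =
        layers (r + 3) ({x, y, z} : Set W) := by
    ext ⟨i, w⟩
    simp only [Set.mem_insert_iff, Set.mem_singleton_iff, Prod.mk.injEq, mem_layers]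
    grind
  rw [hset] at h'
  refine (h'.spansCycle (adj_row hxy.symm)).mono ?_
  rintro e (he | rfl | rfl | rfl | rfl)
  · simp only [Set.mem_insert_iff]
    tauto
  · simp [rung]
  · simp [rung]
  · simp
  · simp [Sym2.eq_swap]

/-- A grid with three columns and `2 (m + 1)` rows has a spanning cycle using every rung `2 j + 1`
of the middle column, and for each `j` that rung of a prescribed outer column. -/
theorem spansCycle_three_columns {x y z : W} (hxy : G.Adj x y) (hyz : G.Adj y z) (hxz : x ≠ z)
    (A : Set ℕ) (m : ℕ) (hm : 2 * (m + 1) ≤ n) :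
    (initialPath n □ G).SpansCycle (layers (2 * (m + 1)) {x, y, z})
      ({e | ∃ j < m, e = rung (2 * j + 1) y ∨ (j ∈ A ∧ e = rung (2 * j + 1) x) ∨
        (j ∉ A ∧ e = rung (2 * j + 1) z)} ∪
        {s((2 * m + 1, x), (2 * m + 1, y)), s((2 * m + 1, y), (2 * m + 1, z))}) := by
  have hxy' := hxy.ne
  have hyz' := hyz.ne
  induction m with
  | zero =>
    have h := ((((((spansPath_singleton (G := initialPath n □ G) (0, y)).cons
      (c := (0, x)) (by simpa using hxy') (adj_row hxy.symm)).cons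
      (c := (1, x)) (by simp) (adj_rung x (by omega))).concat
      (c := (0, z)) (by simp [hyz'.symm, hxz.symm]) (adj_row hyz)).concat
      (c := (1, z)) (by simp [hxz.symm]) (adj_rung z (by omega))).concat
      (c := (1, y)) (by simp [hxy'.symm, hyz']) (adj_row hyz.symm))
    have hset : insert (1, y) (insert (1, z) (insert (0, z) (insert (1, x) (insert (0, x)
        {(0, y)})))) = layers (2 * (0 + 1)) ({x, y, z} : Set W) := by
      ext ⟨i, w⟩
      simp only [Set.mem_insert_iff, Set.mem_singleton_iff, Prod.mk.injEq, mem_layers]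
      grind
    rw [hset] at h
    refine (h.spansCycle (adj_row hxy.symm)).mono ?_
    rintro e (⟨j, hj, -⟩ | rfl | rfl)
    · omega
    · simp
    · simp [Sym2.eq_swap]
  | succ m ih =>
    have h := ih (by omega)
    -- Both top row edges are on the cycle, so the extension can start from either side; this
    -- decides which outer column gets the new odd rung.
    by_cases hA : m ∈ A
    · refine (SpansCycle.add_two_rows hxy hyz hxz (r := 2 * m + 1) (by omega) h
        (by simp)).mono ?_
      rintro e (⟨j, hj, he⟩ | rfl | rfl)
      · rcases Nat.lt_succ_iff_lt_or_eq.1 hj with hj | rfl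
        · refine Or.inl ⟨Or.inl ⟨j, hj, he⟩, ?_⟩
          rcases he with rfl | ⟨-, rfl⟩ | ⟨-, rfl⟩ <;> exact rung_ne_of_fst_eq
        · rcases he with rfl | ⟨-, rfl⟩ | ⟨hn, rfl⟩
          · simp
          · simp
          · exact absurd hA hn
      · exact Or.inr (by simp [mul_add])
      · exact Or.inr (by simp [mul_add])
    · have hQ : ({x, y, z} : Set W) = {z, y, x} := by
        ext; simp only [Set.mem_insert_iff, Set.mem_singleton_iff]; tauto
      rw [hQ] at h ⊢
      refine (SpansCycle.add_two_rows hyz.symm hxy.symm hxz.symm (r := 2 * m + 1) (by omega) h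
        (by simp [Sym2.eq_swap])).mono ?_
      rintro e (⟨j, hj, he⟩ | rfl | rfl)
      · rcases Nat.lt_succ_iff_lt_or_eq.1 hj with hj | rfl
        · refine Or.inl ⟨Or.inl ⟨j, hj, he⟩, ?_⟩
          rcases he with rfl | ⟨-, rfl⟩ | ⟨-, rfl⟩ <;> exact rung_ne_of_fst_eq
        · rcases he with rfl | ⟨hn, rfl⟩ | ⟨-, rfl⟩
          · simp
          · exact absurd hn hA
          · simp
      · exact Or.inr (by simp [mul_add, Sym2.eq_swap])
      · exact Or.inr (by simp [mul_add, Sym2.eq_swap])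

end Grid

/-! ### Merging cycles within a budget of rungs -/

/-- `E` contains the edges of a cycle spanning the `2 (m + 1)` copies of `S`, with `J w` a set of
indices of rungs over `w` in `E`, each vertex having at least `d` such indices and neighbours
in `S` altogether. -/
structure IsMergeable {W : Type*} (G : SimpleGraph W) (m d : ℕ) (S : Set W)
    (E : Set (Sym2 (ℕ × W))) (J : W → Finset ℕ) : Prop where
  spansCycle : (initialPath (2 * (m + 1)) □ G).SpansCycle (layers (2 * (m + 1)) S) E
  le_card : ∀ w ∈ S, d ≤ (J w).card + (G.neighborSet w ∩ S).ncard
  lt : ∀ w ∈ S, ∀ i ∈ J w, i < m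
  rung_mem : ∀ w ∈ S, ∀ i ∈ J w, rung (2 * i + 1) w ∈ E

/-- Over `Q` there are mergeable cycles with any prescribed rung. -/
def IsFlexible {W : Type*} (G : SimpleGraph W) (m d : ℕ) (Q : Set W) : Prop :=
  ∀ v ∈ Q, ∀ j, ∃ E J, G.IsMergeable m d Q E J ∧ (j < m → j ∈ J v)

section Merge

variable {W : Type*} [Finite W] {G : SimpleGraph W} {m d : ℕ}

/-- The index `j` is spent over `u` and over `v` only, and each of them gains the other as a
neighbour inside the union, so the bound survives. -/
theorem IsMergeable.union {S Q : Set W} {E F : Set (Sym2 (ℕ × W))} {J K : W → Finset ℕ}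
    (hS : G.IsMergeable m d S E J) (hQ : G.IsMergeable m d Q F K) (hSQ : Disjoint S Q)
    {u v : W} (hu : u ∈ S) (hv : v ∈ Q) (huv : G.Adj u v) {j : ℕ} (hju : j ∈ J u)
    (hjv : j ∈ K v) : ∃ E' J', G.IsMergeable m d (S ∪ Q) E' J' := by
  classical
  have hjm := hS.lt u hu j hju
  have hlay : layers (2 * (m + 1)) S ∪ layers (2 * (m + 1)) Q = layers (2 * (m + 1)) (S ∪ Q) := by
    ext ⟨i, w⟩
    simp only [Set.mem_union, mem_layers]
    tauto
  have hdis : Disjoint (layers (2 * (m + 1)) S) (layers (2 * (m + 1)) Q) := by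
    rw [Set.disjoint_left]
    rintro ⟨i, w⟩ h1 h2
    exact Set.disjoint_left.1 hSQ h1.2 h2.2
  have hnot : ∀ w ∈ Q, w ∉ S := fun w hw hw' => Set.disjoint_left.1 hSQ hw' hw
  have hcyc := hS.spansCycle.merge hQ.spansCycle hdis (hS.rung_mem u hu j hju)
    (hQ.rung_mem v hv j hjv) (adj_row huv) (adj_row huv)
  rw [hlay] at hcyc
  let B : W → Finset ℕ := fun w => if w ∈ S then J w else K w
  have hBS : ∀ w ∈ S, B w = J w := fun w hw => if_pos hw
  have hBQ : ∀ w ∈ Q, B w = K w := fun w hw => if_neg (hnot w hw)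
  have hmonoS : ∀ w, (G.neighborSet w ∩ S).ncard ≤ (G.neighborSet w ∩ (S ∪ Q)).ncard := fun w =>
    Set.ncard_le_ncard (Set.inter_subset_inter_right _ Set.subset_union_left)
  have hmonoQ : ∀ w, (G.neighborSet w ∩ Q).ncard ≤ (G.neighborSet w ∩ (S ∪ Q)).ncard := fun w =>
    Set.ncard_le_ncard (Set.inter_subset_inter_right _ Set.subset_union_right)
  have hltu : (G.neighborSet u ∩ S).ncard < (G.neighborSet u ∩ (S ∪ Q)).ncard := by
    refine Set.ncard_lt_ncard ⟨Set.inter_subset_inter_right _ Set.subset_union_left, fun h => ?_⟩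
    exact hnot v hv (h ⟨huv, Or.inr hv⟩).2
  have hltv : (G.neighborSet v ∩ Q).ncard < (G.neighborSet v ∩ (S ∪ Q)).ncard := by
    refine Set.ncard_lt_ncard ⟨Set.inter_subset_inter_right _ Set.subset_union_right, fun h => ?_⟩
    exact hnot u (h ⟨huv.symm, Or.inl hu⟩).2 hu
  have hmem : ∀ w i, i ∈ (if w = u ∨ w = v then (B w).erase j else B w) →
      i ∈ B w ∧ (w = u ∨ w = v → i ≠ j) := by
    intro w i hi
    split_ifs at hi with h
    · rw [Finset.mem_erase] at hi
      exact ⟨hi.2, fun _ => hi.1⟩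
    · exact ⟨hi, fun h' => absurd h' h⟩
  refine ⟨_, fun w => if w = u ∨ w = v then (B w).erase j else B w, hcyc, ?_, ?_, ?_⟩
  · intro w hw
    split_ifs with h
    · have hcard := Finset.pred_card_le_card_erase (s := B w) (a := j)
      rcases h with rfl | rfl
      · rw [hBS w hu] at hcard ⊢
        have := hS.le_card w hu
        omega
      · rw [hBQ w hv] at hcard ⊢
        have := hQ.le_card w hv
        omega
    · rcases hw with hw | hw
      · rw [hBS w hw]
        exact (hS.le_card w hw).trans (Nat.add_le_add_left (hmonoS w) _)
      · rw [hBQ w hw]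
        exact (hQ.le_card w hw).trans (Nat.add_le_add_left (hmonoQ w) _)
  · intro w hw i hi
    have hi' := (hmem w i hi).1
    rcases hw with hw | hw
    · exact hS.lt w hw i (hBS w hw ▸ hi')
    · exact hQ.lt w hw i (hBQ w hw ▸ hi')
  · intro w hw i hi
    obtain ⟨hi', hne⟩ := hmem w i hi
    rcases hw with hw | hw
    · refine Or.inl ⟨hS.rung_mem w hw i (hBS w hw ▸ hi'), fun h => ?_⟩
      obtain ⟨h1, h2⟩ := rung_injective (j := 2 * j + 1) (w := u) h
      exact hne (Or.inl h2) (by omega)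
    · refine Or.inr ⟨hQ.rung_mem w hw i (hBQ w hw ▸ hi'), fun h => ?_⟩
      obtain ⟨h1, h2⟩ := rung_injective (j := 2 * j + 1) (w := v) h
      exact hne (Or.inr h2) (by omega)

/-- The neighbour `v` outside `S` keeps the absorbed neighbours of `u` below `d`, so some index
remains over `u`; flexibility supplies the same index over `v`. -/
theorem IsMergeable.union_isFlexible {S Q : Set W} {E : Set (Sym2 (ℕ × W))} {J : W → Finset ℕ}
    (hS : G.IsMergeable m d S E J) (hQ : G.IsFlexible m d Q) (hSQ : Disjoint S Q)
    (hd : ∀ w, (G.neighborSet w).ncard ≤ d) {u v : W} (hu : u ∈ S) (hv : v ∈ Q)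
    (huv : G.Adj u v) : ∃ E' J', G.IsMergeable m d (S ∪ Q) E' J' := by
  have hlt : (G.neighborSet u ∩ S).ncard < (G.neighborSet u).ncard := by
    refine Set.ncard_lt_ncard ⟨Set.inter_subset_left, fun h => ?_⟩
    exact Set.disjoint_left.1 hSQ (h huv).2 hv
  have hne : (J u).Nonempty := by
    rw [← Finset.card_pos]
    have h1 := hS.le_card u hu
    have h2 := hd u
    omega
  obtain ⟨j, hj⟩ := hne
  obtain ⟨F, K, hK, hjK⟩ := hQ v hv j
  exact hS.union hK hSQ hu hv huv hj (hjK (hS.lt u hu j hj))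

theorem one_le_ncard_neighborSet_inter {Q : Set W} {v w : W} (h : G.Adj v w) (hw : w ∈ Q) :
    1 ≤ (G.neighborSet v ∩ Q).ncard :=
  (Set.ncard_pos (Set.toFinite _)).2 ⟨w, h, hw⟩

theorem isFlexible_pair {x y : W} (hxy : G.Adj x y) (hdm : d ≤ m + 1) :
    G.IsFlexible m d {x, y} := by
  intro v _ j
  refine ⟨_, fun _ => Finset.range m,
    ⟨(spansPath_ladder hxy (2 * m + 1) (by omega)).spansCycle (adj_row hxy.symm), ?_, ?_, ?_⟩,
    fun h => Finset.mem_range.2 h⟩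
  · intro w hw
    have h1 : 1 ≤ (G.neighborSet w ∩ {x, y}).ncard := by
      rcases hw with rfl | rfl
      · exact one_le_ncard_neighborSet_inter hxy (by simp)
      · exact one_le_ncard_neighborSet_inter hxy.symm (by simp)
    rw [Finset.card_range]
    omega
  · exact fun w _ i hi => Finset.mem_range.1 hi
  · intro w hw i hi
    have := Finset.mem_range.1 hi
    exact Or.inr ⟨2 * i + 1, by omega, w, hw, rfl⟩

/-- Indices in `A` go to `x`, the others to `z`, all to `y`. Each vertex has a neighbour in the
triple, so `d - 1` indices suffice; the two numerical hypotheses say this for `A` and for its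
complement. -/
theorem isMergeable_triple {x y z : W} (hxy : G.Adj x y) (hyz : G.Adj y z) (hxz : x ≠ z)
    {A : Finset ℕ} (hA : A ⊆ Finset.range m) (hd : d ≤ A.card + 1) (hm : A.card + d ≤ m + 1) :
    ∃ E J, G.IsMergeable m d {x, y, z} E J ∧ A = J x ∧ Finset.range m = J y := by
  classical
  have hxy' := hxy.ne
  have hyz' := hyz.ne
  refine ⟨_, fun w => if w = x then A else if w = y then Finset.range m else Finset.range m \ A,
    ⟨spansCycle_three_columns hxy hyz hxz (A : Set ℕ) m le_rfl, ?_, ?_, ?_⟩,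
    by simp, by simp [hxy'.symm]⟩
  · intro w hw
    have hcard := Finset.card_sdiff_of_subset hA
    have hle := Finset.card_le_card hA
    rw [Finset.card_range] at hcard hle
    have h1 : 1 ≤ (G.neighborSet w ∩ {x, y, z}).ncard := by
      rcases hw with rfl | rfl | rfl
      · exact one_le_ncard_neighborSet_inter hxy (by simp)
      · exact one_le_ncard_neighborSet_inter hyz (by simp)
      · exact one_le_ncard_neighborSet_inter hyz.symm (by simp)
    split_ifs
    · omega
    · rw [Finset.card_range]
      omega
    · omega
  · intro w _ i hi
    split_ifs at hi
    · exact Finset.mem_range.1 (hA hi)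
    · exact Finset.mem_range.1 hi
    · exact Finset.mem_range.1 (Finset.mem_sdiff.1 hi).1
  · intro w hw i hi
    split_ifs at hi with h1 h2
    · subst h1
      exact Or.inl ⟨i, Finset.mem_range.1 (hA hi), Or.inr (Or.inl ⟨hi, rfl⟩)⟩
    · subst h2
      exact Or.inl ⟨i, Finset.mem_range.1 hi, Or.inl rfl⟩
    · rw [Finset.mem_sdiff, Finset.mem_range] at hi
      rcases hw with hw | hw | hw
      · exact absurd hw h1
      · exact absurd hw h2
      · rw [Set.mem_singleton_iff] at hw
        subst hw
        exact Or.inl ⟨i, hi.1, Or.inr (Or.inr ⟨hi.2, rfl⟩)⟩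

theorem isFlexible_triple {x y z : W} (hxy : G.Adj x y) (hyz : G.Adj y z) (hxz : x ≠ z)
    (hd2 : 2 ≤ d) (hdm : 2 * d ≤ m + 2) : G.IsFlexible m d {x, y, z} := by
  intro v hv j
  -- Size `d - 1` suits both outer columns; `2 ≤ d` leaves room for `j`.
  have hA : ∃ A ⊆ Finset.range m, A.card = d - 1 ∧ (j < m → j ∈ A) := by
    by_cases hj : j < m
    · obtain ⟨A, h1, h2, h3⟩ := Finset.exists_subsuperset_card_eq (n := d - 1)
        (Finset.singleton_subset_iff.2 (Finset.mem_range.2 hj))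
        (by rw [Finset.card_singleton]; omega) (by rw [Finset.card_range]; omega)
      exact ⟨A, h2, h3, fun _ => Finset.singleton_subset_iff.1 h1⟩
    · obtain ⟨A, h1, h2⟩ := Finset.exists_subset_card_eq (s := Finset.range m) (n := d - 1)
        (by rw [Finset.card_range]; omega)
      exact ⟨A, h1, h2, fun h => absurd h hj⟩
  obtain ⟨A, hAm, hAc, hjA⟩ := hA
  have hx := isMergeable_triple (d := d) hxy hyz hxz hAm (by omega) (by omega)
  rcases hv with rfl | rfl | rfl
  · obtain ⟨E, J, hJ, hAJ, -⟩ := hx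
    exact ⟨E, J, hJ, fun h => hAJ ▸ hjA h⟩
  · obtain ⟨E, J, hJ, -, hAJ⟩ := hx
    exact ⟨E, J, hJ, fun h => hAJ ▸ Finset.mem_range.2 h⟩
  · obtain ⟨E, J, hJ, hAJ, -⟩ :=
      isMergeable_triple (d := d) hyz.symm hxy.symm hxz.symm hAm (by omega) (by omega)
    have hQ : ({x, y, v} : Set W) = {v, y, x} := by
      ext; simp only [Set.mem_insert_iff, Set.mem_singleton_iff]; tauto
    rw [hQ]
    exact ⟨E, J, hJ, fun h => hAJ ▸ hjA h⟩

/-- The step adding one piece, from nothing or along an edge. -/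
theorem exists_isMergeable_union {S Q : Set W} (hS : S = ∅ ∨ ∃ E J, G.IsMergeable m d S E J)
    (hQ : G.IsFlexible m d Q) (hSQ : Disjoint S Q) (hd : ∀ w, (G.neighborSet w).ncard ≤ d)
    {v : W} (hv : v ∈ Q) (huv : S = ∅ ∨ ∃ u ∈ S, G.Adj u v) :
    ∃ E J, G.IsMergeable m d (S ∪ Q) E J := by
  rcases huv with rfl | ⟨u, hu, huv⟩
  · obtain ⟨E, J, h, -⟩ := hQ v hv 0
    rw [Set.empty_union]
    exact ⟨E, J, h⟩
  · rcases hS with rfl | ⟨E, J, h⟩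
    · exact absurd hu (Set.notMem_empty u)
    · exact h.union_isFlexible hQ hSQ hd hu hv huv

end Merge

/-! ### Absorbing the components of the neighbour choice -/

theorem two_le_of_adj_adj {W : Type*} [Finite W] {G : SimpleGraph W} {d : ℕ}
    (hd : ∀ w, (G.neighborSet w).ncard ≤ d) {x y z : W} (hxy : G.Adj x y) (hyz : G.Adj y z) (hxz : x ≠ z) : 2 ≤ d := by
  refine le_trans ?_ (hd y)
  rw [← Set.ncard_pair hxz]
  refine Set.ncard_le_ncard ?_
  rintro w (rfl | rfl)
  · exact hxy.symm
  · exact hyz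

section Growth

variable {W : Type*} [Fintype W] [DecidableEq W] {G : SimpleGraph W} {m d : ℕ}

theorem fiber_eq_of_card_le_two {f : W → W} {p q : W}
    (h : (Finset.univ.filter fun v => f v = p).card ≤ 2) (hq : f q = p) :
    (∀ w, f w = p → w = q) ∨ ∃ a, a ≠ q ∧ f a = p ∧ ∀ w, f w = p → w = q ∨ w = a := by
  by_cases hall : ∀ w, f w = p → w = q
  · exact Or.inl hall
  · push Not at hall
    obtain ⟨a, ha, haq⟩ := hall
    refine Or.inr ⟨a, haq, ha, fun w hw => ?_⟩
    by_contra! hne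
    have hsub : ({w, q, a} : Finset W) ⊆ Finset.univ.filter fun v => f v = p := by
      intro x hx
      simp only [Finset.mem_insert, Finset.mem_singleton] at hx
      rw [Finset.mem_filter]
      rcases hx with rfl | rfl | rfl
      · exact ⟨Finset.mem_univ _, hw⟩
      · exact ⟨Finset.mem_univ _, hq⟩
      · exact ⟨Finset.mem_univ _, ha⟩
    have h3 := Finset.card_le_card hsub
    rw [Finset.card_eq_three.2 ⟨w, q, a, hne.1, hne.2, haq.symm, rfl⟩] at h3
    omega

/-- Adding a whole component of the functional graph of `f`. -/
theorem exists_isMergeable_union_component {f : W → W} (hadj : ∀ v, G.Adj v (f v))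
    (hfib : ∀ w, (Finset.univ.filter fun v => f v = w).card ≤ 2) (hinv : ∀ v, f (f (f v)) = f v)
    (hd : ∀ w, (G.neighborSet w).ncard ≤ d) (hdm : 2 * d ≤ m + 2) {S : Set W}
    (hS : S = ∅ ∨ ∃ E J, G.IsMergeable m d S E J) (hclosed : ∀ w, f w ∈ S ↔ w ∈ S) {v : W}
    (hv : v ∉ S) (huv : S = ∅ ∨ ∃ u ∈ S, G.Adj u v) :
    ∃ E J, G.IsMergeable m d (S ∪ {w | f w = f v ∨ f w = f (f v)}) E J := by
  obtain ⟨p, hp⟩ : ∃ p, p = f v := ⟨_, rfl⟩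
  obtain ⟨q, hq⟩ : ∃ q, q = f p := ⟨_, rfl⟩
  have hqp : f q = p := by rw [hq, hp, hinv]
  rw [← hp, ← hq]
  have hpS : p ∉ S := by rwa [hp, hclosed]
  have hqS : q ∉ S := by rwa [hq, hclosed]
  have hpq : G.Adj p q := hq ▸ hadj p
  have hpq' := hpq.ne
  have hdm' : d ≤ m + 1 := by omega
  have hnS : ∀ w, f w = p ∨ f w = q → w ∉ S := by
    rintro w (h | h) hw
    · exact hpS (h ▸ (hclosed w).2 hw)
    · exact hqS (h ▸ (hclosed w).2 hw)
  have hdisj : ∀ Q : Set W, Q ⊆ {w | f w = p ∨ f w = q} → Disjoint S Q := fun Q hQ =>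
    Set.disjoint_left.2 fun w hw hw' => hnS w (hQ hw') hw
  have hvC : v ∈ {w | f w = p ∨ f w = q} := Or.inl hp.symm
  -- The component is the two-cycle `p`, `q` with at most one further vertex attached at each end.
  rcases fiber_eq_of_card_le_two (hfib p) hqp with hP | ⟨a, haq, hap, hP⟩ <;>
  rcases fiber_eq_of_card_le_two (hfib q) hq.symm with hQ | ⟨b, hbp, hbq, hQ⟩
  · have hC : {w | f w = p ∨ f w = q} = {p, q} := by
      ext w
      simp only [Set.mem_ofPred_eq, Set.mem_insert_iff, Set.mem_singleton_iff]
      grind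
    refine exists_isMergeable_union hS ?_ (hdisj _ subset_rfl) hd hvC huv
    rw [hC]
    exact isFlexible_pair hpq hdm'
  · have hC : {w | f w = p ∨ f w = q} = {p, q, b} := by
      ext w
      simp only [Set.mem_ofPred_eq, Set.mem_insert_iff, Set.mem_singleton_iff]
      grind
    have hqb : G.Adj q b := by
      have := hadj b
      rw [hbq] at this
      exact this.symm
    refine exists_isMergeable_union hS ?_ (hdisj _ subset_rfl) hd hvC huv
    rw [hC]
    exact isFlexible_triple hpq hqb hbp.symm (two_le_of_adj_adj hd hpq hqb hbp.symm) hdm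
  · have hC : {w | f w = p ∨ f w = q} = {a, p, q} := by
      ext w
      simp only [Set.mem_ofPred_eq, Set.mem_insert_iff, Set.mem_singleton_iff]
      grind
    have hap' : G.Adj a p := hap ▸ hadj a
    refine exists_isMergeable_union hS ?_ (hdisj _ subset_rfl) hd hvC huv
    rw [hC]
    exact isFlexible_triple hap' hpq haq (two_le_of_adj_adj hd hap' hpq haq) hdm
  · have hC : {w | f w = p ∨ f w = q} = {a, p} ∪ {q, b} := by
      ext w
      simp only [Set.mem_ofPred_eq, Set.mem_union, Set.mem_insert_iff, Set.mem_singleton_iff]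
      constructor
      · rintro (h | h)
        · rcases hP w h with rfl | rfl <;> simp
        · rcases hQ w h with rfl | rfl <;> simp
      · rintro ((rfl | rfl) | (rfl | rfl))
        · exact Or.inl hap
        · exact Or.inr hq.symm
        · exact Or.inl hqp
        · exact Or.inr hbq
    have hap' : G.Adj a p := hap ▸ hadj a
    have hqb : G.Adj q b := by
      have := hadj b
      rw [hbq] at this
      exact this.symm
    have hab : a ≠ b := by
      rintro rfl
      exact hpq' (hap.symm.trans hbq)
    have hap'' := hap'.ne
    have hqb' := hqb.ne
    have hfl₁ : G.IsFlexible m d {a, p} := isFlexible_pair hap' hdm'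
    have hfl₂ : G.IsFlexible m d {q, b} := isFlexible_pair hqb hdm'
    have hdis : Disjoint ({a, p} : Set W) {q, b} := by
      rw [Set.disjoint_left]
      rintro w (rfl | rfl) (h | h) <;> grind
    have h₁ := hdisj {a, p} (by rw [hC]; exact Set.subset_union_left)
    have h₂ := hdisj {q, b} (by rw [hC]; exact Set.subset_union_right)
    rw [hC]
    -- Only `v` is known to be adjacent to `S`, so its half goes first; the other half follows along
    -- the edge `pq`.
    rcases hP v hp.symm with rfl | rfl
    · rw [Set.union_comm {a, p}, ← Set.union_assoc]
      exact exists_isMergeable_union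
        (Or.inr (exists_isMergeable_union hS hfl₂ h₂ hd (Set.mem_insert _ _) huv)) hfl₁
        (Set.disjoint_union_left.2 ⟨h₁, hdis.symm⟩) hd (v := p) (by simp)
        (Or.inr ⟨v, by simp, hpq.symm⟩)
    · rw [← Set.union_assoc]
      exact exists_isMergeable_union
        (Or.inr (exists_isMergeable_union hS hfl₁ h₁ hd (Set.mem_insert _ _) huv)) hfl₂
        (Set.disjoint_union_left.2 ⟨h₂, hdis⟩) hd (v := q) (by simp)
        (Or.inr ⟨p, by simp, hpq⟩)

/-- Take a largest mergeable (or empty) union of components. Connectedness gives an edge leaving any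
nonempty proper one, and the component at its far end could be added. -/
theorem exists_isMergeable_univ (hconn : G.Connected) {f : W → W} (hadj : ∀ v, G.Adj v (f v))
    (hfib : ∀ w, (Finset.univ.filter fun v => f v = w).card ≤ 2) (hinv : ∀ v, f (f (f v)) = f v)
    (hd : ∀ w, (G.neighborSet w).ncard ≤ d) (hdm : 2 * d ≤ m + 2) :
    ∃ E J, G.IsMergeable m d Set.univ E J := by
  let P : Set (Set W) := {S | (S = ∅ ∨ ∃ E J, G.IsMergeable m d S E J) ∧ ∀ w, f w ∈ S ↔ w ∈ S}
  obtain ⟨S, hSP, hmax⟩ := Set.exists_max_image P Set.ncard (Set.toFinite _)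
    ⟨∅, Or.inl rfl, fun _ => Iff.rfl⟩
  obtain ⟨hS, hclosed⟩ := hSP
  have hstep : ∀ v, v ∉ S → ¬ (S = ∅ ∨ ∃ u ∈ S, G.Adj u v) := by
    intro v hv huv
    have hnew := exists_isMergeable_union_component hadj hfib hinv hd hdm hS hclosed hv huv
    have hle := hmax (S ∪ {w | f w = f v ∨ f w = f (f v)}) ⟨Or.inr hnew, fun w => by
      have hC : f (f w) = f v ∨ f (f w) = f (f v) ↔ f w = f v ∨ f w = f (f v) := by
        have h1 := hinv w
        have h2 := hinv v
        constructor
        · rintro (h | h)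
          · exact Or.inr (by rw [← h1, h])
          · exact Or.inl (by rw [← h1, h, h2])
        · rintro (h | h)
          · exact Or.inr (by rw [h])
          · exact Or.inl (by rw [h, h2])
      exact or_congr (hclosed w) hC⟩
    refine absurd hle (not_le.2 (Set.ncard_lt_ncard ⟨Set.subset_union_left, fun h => hv ?_⟩))
    exact h (Or.inr (Or.inl rfl))
  have huniv : S = Set.univ := by
    by_contra hne
    obtain ⟨v, hv⟩ := (Set.ne_univ_iff_exists_notMem S).1 hne
    rcases Set.eq_empty_or_nonempty S with hemp | ⟨u, hu⟩
    · exact hstep v hv (Or.inl hemp)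
    · obtain ⟨p⟩ := hconn.preconnected u v
      obtain ⟨e, -, h1, h2⟩ := p.exists_boundary_dart S hu hv
      exact hstep e.snd h2 (Or.inr ⟨e.fst, h1, e.adj⟩)
  rcases hS with hemp | h
  · obtain ⟨v⟩ := hconn.nonempty
    exact absurd (huniv ▸ Set.mem_univ v : v ∈ S) (hemp ▸ Set.notMem_empty v)
  · exact huniv ▸ h

end Growth

/-! ### Transfer to the product with a traceable graph -/

/-- A path with at least `n` vertices receives a homomorphism from the path `0, …, n - 1`, and so
does its box product with any graph. -/
def Walk.initialPathBoxHom {V W : Type*} {G : SimpleGraph V} {a b : V} (p : G.Walk a b) {n : ℕ}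
    (hn : n ≤ p.length + 1) (H : SimpleGraph W) : (initialPath n □ H) →g (G □ H) where
  toFun x := (p.getVert x.1, x.2)
  map_rel' := by
    rintro ⟨i, v⟩ ⟨j, w⟩ h
    rw [boxProd_adj] at h ⊢
    rcases h with ⟨⟨h, hi, hj⟩, hvw⟩ | ⟨h, hij⟩
    · refine Or.inl ⟨?_, hvw⟩
      rcases h with h | h <;> dsimp only at h hi hj ⊢ <;> subst h
      · exact p.adj_getVert_succ (by omega)
      · exact (p.adj_getVert_succ (by omega)).symm
    · exact Or.inr ⟨h, congrArg p.getVert hij⟩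

end SimpleGraph

open SimpleGraph in
theorem corollary1p3 {V₁ : Type*} {V₂ : Type*} [Fintype V₁] [Fintype V₂]
    [DecidableEq V₁] [DecidableEq V₂]
    (G₁ : SimpleGraph V₁) (G₂ : SimpleGraph V₂) [DecidableRel G₂.Adj]
    [Nontrivial V₂]
    (hconn : G₂.Connected)
    (hdeg : G₂.maxDegree ≤ 2 * G₂.minDegree)
    (htrace : G₁.IsTraceable)
    (heven : Even (Fintype.card V₁))
    (hcard : 4 * (G₂.maxDegree : ℤ) - 2 ≤ (Fintype.card V₁ : ℤ)) :
    (SimpleGraph.boxProd G₁ G₂).HasHamiltonianCycle := by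
  have hpos := hconn.preconnected.minDegree_pos_of_nontrivial
  have hle := G₂.minDegree_le_maxDegree
  obtain ⟨m, hm⟩ : ∃ m, Fintype.card V₁ = 2 * (m + 1) := by
    obtain ⟨k, hk⟩ := heven
    -- Here `k ≥ 1`, because positive degrees make the order of `G₁` at least 2.
    exact ⟨k - 1, by omega⟩
  obtain ⟨f, hadj, hfib, hinv⟩ := G₂.exists_involutive_neighbor_choice hpos hdeg
  obtain ⟨E, J, hcyc, -⟩ := exists_isMergeable_univ (m := m) (d := G₂.maxDegree) hconn hadj hfib
    hinv (fun w => by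
      rw [← coe_neighborFinset, Set.ncard_coe_finset, card_neighborFinset_eq_degree]
      exact G₂.degree_le_maxDegree w) (by omega)
  obtain ⟨a, b, p, hp⟩ := htrace
  have hlen : p.length + 1 = 2 * (m + 1) := by rw [← p.length_support, hp.length_support, hm]
  refine hcyc.hasHamiltonianCycle (p.initialPathBoxHom hlen.ge G₂) ?_ ?_ ?_
  · rintro ⟨i, v⟩ hi ⟨j, w⟩ hj h
    obtain ⟨h1, h2⟩ := Prod.mk.inj h
    refine Prod.ext (hp.isPath.getVert_injOn ?_ ?_ h1) h2
    · have := hi.1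
      simp only [Set.mem_ofPred_eq] at this ⊢
      omega
    · have := hj.1
      simp only [Set.mem_ofPred_eq] at this ⊢
      omega
  · rintro ⟨x, w⟩
    obtain ⟨i, hi, hil⟩ := Walk.mem_support_iff_exists_getVert.1 (hp.mem_support x)
    exact ⟨(i, w), ⟨by dsimp only; omega, Set.mem_univ w⟩, Prod.ext hi rfl⟩
  · obtain ⟨x, y, hxy⟩ := exists_pair_ne V₂
    exact ⟨(0, x), ⟨by dsimp only; omega, Set.mem_univ _⟩,
      (1, x), ⟨by dsimp only; omega, Set.mem_univ _⟩,
      (0, y), ⟨by dsimp only; omega, Set.mem_univ _⟩, by simp, by simpa using hxy, by simp⟩
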